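/- Let $\mathsf{Brw}$ and a binary relation $\leq$ on $\mathsf{Brw}$, valued in propositions, be defined simultaneously as the quotient inductive-inductive type (the initial algebra) with the following constructors, where $x<y$ abbreviates $\mathsf{succ}\,x\leq y$ and a sequence $f:\mathbb N\to\mathsf{Brw}$ is called strictly increasing if $f(k)<f(k+1)$ for all $k$. The set $\mathsf{Brw}$ is generated by $\mathsf{zero}:\mathsf{Brw}$, $\mathsf{succ}:\mathsf{Brw}\to\mathsf{Brw}$, and $\mathsf{limit}\,f:\mathsf{Brw}$ for every strictly increasing sequence $f$, with the identifications $\mathsf{limit}\,f=\mathsf{limit}\,g$ for all strictly increasing sequences $f,g$ that are bisimilar, i.e. such that $\forall k\,\exists n\,(f(k)\leq g(n))$ and $\forall k\,\exists n\,(g(k)\leq f(n))$. The relation $\leq$ is generated by: $\mathsf{zero}\leq x$; if $x\leq y$ and $y\leq z$ then $x\leq z$; if $x\leq y$ then $\mathsf{succ}\,x\leq\mathsf{succ}\,y$; if $x\leq f(k)$ for some $k$ then $x\leq\mathsf{limit}\,f$; if $f(k)\leq x$ for all $k$ then $\mathsf{limit}\,f\leq x$. Then the relation $<$ on $\mathsf{Brw}$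 is well-founded, i.e. every element of $\mathsf{Brw}$ is accessible with respect to $<$. Moreover, for every strictly increasing sequence $f$ and every $x:\mathsf{Brw}$ with $x<\mathsf{limit}\,f$ there is an $n$ with $x<f(n)$. -/

import Mathlib

/-! ### Relations and sequences -/

/-- `f` is simulated by `g` with respect to the relation `r`. -/
def SimulatedBy {A : Type*} (r : A → A → Prop) (f g : ℕ → A) : Prop :=
  ∀ k, ∃ n, r (f k) (g n)

/-- `f` and `g` are bisimilar with respect to the relation `r`. -/
def Bisimilar {A : Type*} (r : A → A → Prop) (f g : ℕ → A) : Prop :=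
  SimulatedBy r f g ∧ SimulatedBy r g f

/-- The sequence `f` is increasing with respect to the relation `r`. -/
def IsIncreasing {A : Type*} (r : A → A → Prop) (f : ℕ → A) : Prop :=
  ∀ k, r (f k) (f (k + 1))

/-! ### The signature of Brouwer trees

The algebras of the quotient inductive-inductive signature. Types in Lean are sets and propositions
are proof-irrelevant, so the two truncation constructors need no mention. -/

/-- A type and a relation `le` on it, with all the constructors of Brouwer trees. The strict
relation is `fun x y => le (succ x) y`. -/
structure BrwAlgebra where
  carrier : Type*
  le : carrier → carrier → Prop
  zero : carrier
  succ : carrier → carrier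
  limit : (f : ℕ → carrier) → IsIncreasing (fun x y => le (succ x) y) f → carrier
  bisim : ∀ f g hf hg, Bisimilar le f g → limit f hf = limit g hg
  zero_le : ∀ x, le zero x
  le_trans : ∀ x y z, le x y → le y z → le x z
  succ_mono : ∀ x y, le x y → le (succ x) (succ y)
  le_cocone : ∀ x f hf k, le x (f k) → le x (limit f hf)
  le_limiting : ∀ x f hf, (∀ k, le (f k) x) → le (limit f hf) x

/-- Morphisms of algebras preserve the relation and all the point constructors. -/
structure BrwAlgebra.Hom (A B : BrwAlgebra) where
  toFun : A.carrier → B.carrier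
  map_le : ∀ x y, A.le x y → B.le (toFun x) (toFun y)
  map_zero : toFun A.zero = B.zero
  map_succ : ∀ x, toFun (A.succ x) = B.succ (toFun x)
  map_limit : ∀ f hf, toFun (A.limit f hf) =
    B.limit (fun n => toFun (f n)) (fun k =>
      show B.le (B.succ (toFun (f k))) (toFun (f (k + 1))) from map_succ (f k) ▸ map_le _ _ (hf k))

/-! ### Construction of the type of Brouwer trees -/

/-- Raw trees, without any restriction on limits and without identifications. -/
inductive RawBrw : Type where
  | zero : RawBrw
  | succ : RawBrw → RawBrw
  | limit : (ℕ → RawBrw) → RawBrw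

namespace RawBrw

mutual

/-- The raw trees in which limits are taken of strictly increasing sequences only. -/
inductive Wf : RawBrw → Prop where
  | zero : Wf zero
  | succ {x} : Wf x → Wf (succ x)
  | limit {f : ℕ → RawBrw} : (∀ n, Wf (f n)) → (∀ n, Le (succ (f n)) (f (n + 1))) →
      Wf (limit f)

/-- The order on well-formed raw trees. -/
inductive Le : RawBrw → RawBrw → Prop where
  | zero_le {x} : Wf x → Le zero x
  | trans {x y z} : Le x y → Le y z → Le x z
  | succ_mono {x y} : Le x y → Le (succ x) (succ y)
  | cocone {x} {f : ℕ → RawBrw} (k : ℕ) : Wf (limit f) → Le x (f k) → Le x (limit f)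
  | limiting {x} {f : ℕ → RawBrw} : Wf (limit f) → (∀ k, Le (f k) x) → Le (limit f) x
  | congr {x x' y y'} : Eqv x x' → Eqv y y' → Le x y → Le x' y'

/-- The identifications between well-formed raw trees: the least congruence that identifies the
limits of bisimilar sequences. -/
inductive Eqv : RawBrw → RawBrw → Prop where
  | refl {x} : Wf x → Eqv x x
  | symm {x y} : Eqv x y → Eqv y x
  | trans {x y z} : Eqv x y → Eqv y z → Eqv x z
  | succ_congr {x y} : Eqv x y → Eqv (succ x) (succ y)
  | limit_congr {f g : ℕ → RawBrw} : Wf (limit f) → Wf (limit g) → (∀ n, Eqv (f n) (g n)) →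
      Eqv (limit f) (limit g)
  | bisim {f g : ℕ → RawBrw} (u v : ℕ → ℕ) : Wf (limit f) → Wf (limit g) →
      (∀ k, Le (f k) (g (u k))) → (∀ k, Le (g k) (f (v k))) → Eqv (limit f) (limit g)

end

/-- The identifications as an equivalence relation on the well-formed raw trees. -/
instance setoid : Setoid {t : RawBrw // Wf t} where
  r s t := Eqv s.1 t.1
  iseqv := ⟨fun t => .refl t.2, .symm, .trans⟩

end RawBrw

/-- The type of Brouwer trees. -/
def Brw : Type := Quotient RawBrw.setoid

namespace Brw

/-- The Brouwer tree represented by a well-formed raw tree. -/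
def mk (t : {t : RawBrw // RawBrw.Wf t}) : Brw := Quotient.mk _ t

instance : LE Brw where
  le := Quotient.lift₂ (fun s t => RawBrw.Le s.1 t.1) fun _ _ _ _ h₁ h₂ =>
    propext ⟨.congr h₁ h₂, .congr (.symm h₁) (.symm h₂)⟩

def zero : Brw := mk ⟨.zero, .zero⟩

def succ : Brw → Brw :=
  Quotient.map (fun t => ⟨.succ t.1, .succ t.2⟩) fun _ _ h => .succ_congr h

/-- The strict order: `x < y` means `succ x ≤ y`. -/
instance : LT Brw where
  lt x y := succ x ≤ y

/-- A chosen raw tree that represents a Brouwer tree. -/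
noncomputable def rep (x : Brw) : {t : RawBrw // RawBrw.Wf t} := Quotient.out x

theorem mk_rep (x : Brw) : mk (rep x) = x := Quotient.out_eq x

theorem rep_le {x y : Brw} : RawBrw.Le (rep x).1 (rep y).1 ↔ x ≤ y := by
  conv_rhs => rw [← mk_rep x, ← mk_rep y]
  exact Iff.rfl

theorem succ_rep_le {x y : Brw} : RawBrw.Le (.succ (rep x).1) (rep y).1 ↔ x < y := by
  conv_rhs => rw [← mk_rep x, ← mk_rep y]
  exact Iff.rfl

theorem wf_limit_rep {f : ℕ → Brw} (hf : IsIncreasing (· < ·) f) :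
    RawBrw.Wf (.limit fun n => (rep (f n)).1) :=
  .limit (fun n => (rep (f n)).2) fun n => succ_rep_le.2 (hf n)

/-- The limit of a strictly increasing sequence. -/
noncomputable def limit (f : ℕ → Brw) (hf : IsIncreasing (· < ·) f) : Brw :=
  mk ⟨.limit fun n => (rep (f n)).1, wf_limit_rep hf⟩

/-- Brouwer trees with all their constructors. -/
noncomputable def algebra : BrwAlgebra where
  carrier := Brw
  le := (· ≤ ·)
  zero := zero
  succ := succ
  limit := limit
  bisim f g hf hg h := by
    choose u hu using h.1
    choose v hv using h.2
    exact Quotient.sound (.bisim u v (wf_limit_rep hf) (wf_limit_rep hg)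
      (fun k => rep_le.2 (hu k)) (fun k => rep_le.2 (hv k)))
  zero_le x := Quotient.inductionOn x fun t => .zero_le t.2
  le_trans x y z := Quotient.inductionOn₃ x y z fun _ _ _ h₁ h₂ => RawBrw.Le.trans h₁ h₂
  succ_mono x y := Quotient.inductionOn₂ x y fun _ _ h => RawBrw.Le.succ_mono h
  le_cocone x f hf k h := by
    rw [← mk_rep x]
    exact RawBrw.Le.cocone k (wf_limit_rep hf) (rep_le.2 h)
  le_limiting x f hf h := by
    rw [← mk_rep x]
    exact RawBrw.Le.limiting (wf_limit_rep hf) fun k => rep_le.2 (h k)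

/-! ### Universal property

The construction is the quotient inductive-inductive type: it is the initial algebra of the
signature (with respect to algebras in an arbitrary universe). -/

/-- The graph of the interpretation of raw trees in an algebra. -/
inductive Eval (A : BrwAlgebra) : RawBrw → A.carrier → Prop where
  | zero : Eval A .zero A.zero
  | succ {t a} : Eval A t a → Eval A (.succ t) (A.succ a)
  | limit {f : ℕ → RawBrw} {g : ℕ → A.carrier} (hg) : (∀ n, Eval A (f n) (g n)) →
      Eval A (.limit f) (A.limit g hg)

theorem Eval.unique {A : BrwAlgebra} {t a b} (h : Eval A t a) (h' : Eval A t b) : a = b := by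
  induction h generalizing b with
  | zero => cases h'; rfl
  | succ _ ih => cases h' with | succ h => rw [ih h]
  | @limit f g hg _ ih =>
    cases h' with
    | @limit _ g' hg' h =>
      obtain rfl : g = g' := funext fun n => ih n (h n)
      rfl

mutual

theorem eval_wf (A : BrwAlgebra) {t} : RawBrw.Wf t → ∃ a, Eval A t a
  | .zero => ⟨_, .zero⟩
  | .succ h => let ⟨_, ha⟩ := eval_wf A h; ⟨_, .succ ha⟩
  | .limit h h' => by
    have ih := fun n => eval_wf A (h n)
    have ih' := fun n => eval_le A (h' n)
    choose g hg using ih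
    refine ⟨_, .limit (g := g) (fun n => ?_) hg⟩
    obtain ⟨a, b, ha, hb, hab⟩ := ih' n
    rwa [ha.unique (.succ (hg n)), hb.unique (hg (n + 1))] at hab

theorem eval_le (A : BrwAlgebra) {s t} : RawBrw.Le s t →
    ∃ a b, Eval A s a ∧ Eval A t b ∧ A.le a b
  | .zero_le h => let ⟨_, ha⟩ := eval_wf A h; ⟨_, _, .zero, ha, A.zero_le _⟩
  | .trans h₁ h₂ => by
    obtain ⟨a, b, ha, hb, hab⟩ := eval_le A h₁
    obtain ⟨b', c, hb', hc, hbc⟩ := eval_le A h₂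
    obtain rfl := hb.unique hb'
    exact ⟨a, c, ha, hc, A.le_trans _ _ _ hab hbc⟩
  | .succ_mono h =>
    let ⟨_, _, ha, hb, hab⟩ := eval_le A h
    ⟨_, _, .succ ha, .succ hb, A.succ_mono _ _ hab⟩
  | .cocone k h h' => by
    obtain ⟨c, hc⟩ := eval_wf A h
    obtain ⟨a, b, ha, hb, hab⟩ := eval_le A h'
    cases hc with
    | limit hg hc =>
      obtain rfl := hb.unique (hc k)
      exact ⟨_, _, ha, .limit hg hc, A.le_cocone _ _ _ k hab⟩
  | .limiting h h' => by
    obtain ⟨c, hc⟩ := eval_wf A h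
    have ih := fun k => eval_le A (h' k)
    cases hc with
    | limit hg hc =>
      obtain ⟨_, x, _, hx, _⟩ := ih 0
      refine ⟨_, x, .limit hg hc, hx, A.le_limiting _ _ _ fun k => ?_⟩
      obtain ⟨a, b, ha, hb, hab⟩ := ih k
      rwa [ha.unique (hc k), hb.unique hx] at hab
  | .congr h₁ h₂ h => by
    obtain ⟨a, b, ha, hb, hab⟩ := eval_le A h
    obtain ⟨a', ha₁, ha₂⟩ := eval_eqv A h₁
    obtain ⟨b', hb₁, hb₂⟩ := eval_eqv A h₂
    rw [ha.unique ha₁, hb.unique hb₁] at hab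
    exact ⟨_, _, ha₂, hb₂, hab⟩

theorem eval_eqv (A : BrwAlgebra) {s t} : RawBrw.Eqv s t → ∃ a, Eval A s a ∧ Eval A t a
  | .refl h => let ⟨_, ha⟩ := eval_wf A h; ⟨_, ha, ha⟩
  | .symm h => let ⟨_, ha, hb⟩ := eval_eqv A h; ⟨_, hb, ha⟩
  | .trans h₁ h₂ => by
    obtain ⟨a, ha, hb⟩ := eval_eqv A h₁
    obtain ⟨b, hb', hc⟩ := eval_eqv A h₂
    obtain rfl := hb.unique hb'
    exact ⟨_, ha, hc⟩
  | .succ_congr h => let ⟨_, ha, hb⟩ := eval_eqv A h; ⟨_, .succ ha, .succ hb⟩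
  | .limit_congr h _ h' => by
    obtain ⟨c, hc⟩ := eval_wf A h
    have ih := fun k => eval_eqv A (h' k)
    cases hc with
    | limit hg hc =>
      refine ⟨_, .limit hg hc, .limit hg fun n => ?_⟩
      obtain ⟨a, ha, hb⟩ := ih n
      rwa [ha.unique (hc n)] at hb
  | .bisim u v h₁ h₂ h₃ h₄ => by
    obtain ⟨c, hc⟩ := eval_wf A h₁
    obtain ⟨d, hd⟩ := eval_wf A h₂
    have ih₃ := fun k => eval_le A (h₃ k)
    have ih₄ := fun k => eval_le A (h₄ k)
    refine ⟨c, hc, ?_⟩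
    cases hc with
    | limit hg hc =>
    cases hd with
    | limit hg' hd =>
      rw [A.bisim _ _ hg hg' ⟨fun k => ⟨u k, ?_⟩, fun k => ⟨v k, ?_⟩⟩]
      · exact .limit hg' hd
      · obtain ⟨a, b, ha, hb, hab⟩ := ih₃ k
        rwa [ha.unique (hc k), hb.unique (hd (u k))] at hab
      · obtain ⟨a, b, ha, hb, hab⟩ := ih₄ k
        rwa [ha.unique (hd k), hb.unique (hc (v k))] at hab

end

theorem mk_limit {f : ℕ → RawBrw} (h : ∀ n, RawBrw.Wf (f n)) (hf : RawBrw.Wf (.limit f))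
    (hf' : IsIncreasing (· < ·) fun n => mk ⟨f n, h n⟩) :
    mk ⟨.limit f, hf⟩ = limit (fun n => mk ⟨f n, h n⟩) hf' :=
  Quotient.sound (.limit_congr hf (wf_limit_rep hf') fun n =>
    .symm (Quotient.exact (mk_rep (mk ⟨f n, h n⟩))))

theorem eval_hom {A : BrwAlgebra} (φ : algebra.Hom A) (t : RawBrw) (ht : RawBrw.Wf t) :
    Eval A t (φ.toFun (mk ⟨t, ht⟩)) := by
  induction t with
  | zero =>
    have h := φ.map_zero
    exact h ▸ .zero
  | succ t ih =>
    cases ht with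
    | succ ht =>
      have h := φ.map_succ (mk ⟨t, ht⟩)
      exact h ▸ .succ (ih ht)
  | limit f ih =>
    cases id ht with
    | limit h h' =>
      have e := φ.map_limit (fun n => mk ⟨f n, h n⟩) h'
      rw [mk_limit h ht h']
      exact e ▸ .limit _ fun n => ih n (h n)

theorem algebra_initial (A : BrwAlgebra) : Nonempty (Unique (algebra.Hom A)) := by
  have ev (x : Brw) : ∃ a, ∀ t : {t : RawBrw // RawBrw.Wf t},
      mk t = x → Eval A t.1 a := by
    obtain ⟨a, ha⟩ := eval_wf A (rep x).2
    refine ⟨a, fun t ht => ?_⟩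
    obtain ⟨b, hb, hb'⟩ := eval_eqv A (Quotient.exact (ht.trans (mk_rep x).symm))
    rwa [ha.unique hb']
  choose φ hφ using ev
  refine ⟨⟨⟨⟨φ, fun x y h => ?_, ?_, fun x => ?_, fun f hf => ?_⟩⟩, fun ψ => ?_⟩⟩
  · obtain ⟨a, b, ha, hb, hab⟩ := eval_le A (rep_le.2 h)
    rwa [ha.unique (hφ x _ (mk_rep x)), hb.unique (hφ y _ (mk_rep y))] at hab
  · exact (hφ _ ⟨.zero, .zero⟩ rfl).unique .zero
  · refine (hφ _ ⟨.succ (rep x).1, .succ (rep x).2⟩ ?_).unique (.succ (hφ x _ (mk_rep x)))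
    exact congrArg succ (mk_rep x)
  · exact (hφ _ ⟨_, wf_limit_rep hf⟩ rfl).unique
      (.limit _ fun n => hφ (f n) _ (mk_rep (f n)))
  · have : ψ.toFun = φ := funext fun x => by
      induction x using Quotient.inductionOn with
      | h t => exact (eval_hom ψ t.1 t.2).unique (hφ _ t rfl)
    cases ψ
    subst this
    rfl

end Brw

-- Ordinals with zero, successor and countable suprema form a `BrwAlgebra`, so initiality gives a
-- monotone map `toOrdinal` that commutes with the constructors. It turns `succ x ≤ y` into a strict
-- inequality of ordinals, so well-foundedness of `<` is pulled back from the ordinals. It also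
-- reflects the order (`le_of_toOrdinal_le`), so `x < limit f` says exactly that an ordinal lies
-- strictly below a supremum, and hence below one of its terms.

/-- The ordinals as an algebra of Brouwer trees: limits are suprema. -/
noncomputable def ordinalAlgebra : BrwAlgebra where
  carrier := Ordinal.{0}
  le := (· ≤ ·)
  zero := 0
  succ := Order.succ
  limit f _ := ⨆ n, f n
  bisim f g _ _ h := le_antisymm
    (Ordinal.iSup_le fun k => let ⟨n, hn⟩ := h.1 k; hn.trans (Ordinal.le_iSup g n))
    (Ordinal.iSup_le fun k => let ⟨n, hn⟩ := h.2 k; hn.trans (Ordinal.le_iSup f n))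
  zero_le _ := zero_le
  le_trans _ _ _ := le_trans
  succ_mono _ _ := Order.succ_le_succ
  le_cocone _ f _ k h := h.trans (Ordinal.le_iSup f k)
  le_limiting _ _ _ h := Ordinal.iSup_le h

namespace Brw

/-- Induction on a raw representative. A raw limit need not be built from the representatives that
`limit` chooses; `mk_limit` bridges this gap. -/
theorem induction {motive : Brw → Prop} (zero : motive zero)
    (succ : ∀ x, motive x → motive (succ x))
    (limit : ∀ f hf, (∀ n, motive (f n)) → motive (limit f hf)) (x : Brw) : motive x := by
  obtain ⟨⟨t, ht⟩, rfl⟩ : ∃ t, mk t = x := ⟨rep x, mk_rep x⟩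
  induction t with
  | zero => exact zero
  | succ t ih =>
    cases ht with
    | succ ht => exact succ _ (ih ht)
  | limit f ih =>
    cases id ht with
    | limit h h' =>
      rw [mk_limit h ht h']
      exact limit _ _ fun n => ih n (h n)

/-- The interpretation of Brouwer trees as ordinals. -/
noncomputable def homOrdinal : algebra.Hom ordinalAlgebra :=
  (Classical.choice (algebra_initial ordinalAlgebra)).default

/-- The ordinal that a Brouwer tree denotes. -/
noncomputable def toOrdinal (x : Brw) : Ordinal.{0} := homOrdinal.toFun x

theorem toOrdinal_zero : toOrdinal zero = 0 := homOrdinal.map_zero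

theorem toOrdinal_succ (x : Brw) : toOrdinal (succ x) = Order.succ (toOrdinal x) :=
  homOrdinal.map_succ x

theorem toOrdinal_limit (f : ℕ → Brw) (hf : IsIncreasing (· < ·) f) :
    toOrdinal (limit f hf) = ⨆ n, toOrdinal (f n) :=
  homOrdinal.map_limit f hf

theorem toOrdinal_mono {x y : Brw} (h : x ≤ y) : toOrdinal x ≤ toOrdinal y :=
  homOrdinal.map_le x y h

theorem toOrdinal_strictMono {x y : Brw} (h : x < y) : toOrdinal x < toOrdinal y :=
  Order.succ_le_iff.1 (toOrdinal_succ x ▸ toOrdinal_mono h)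

/-- Each constructor of `≤` has an ordinal counterpart that can be inverted by classical reasoning,
so the derivation of `x ≤ y` is rebuilt by induction on `x`, with `y` arbitrary. -/
theorem le_of_toOrdinal_le {x y : Brw} (h : toOrdinal x ≤ toOrdinal y) : x ≤ y := by
  induction x using induction generalizing y with
  | zero => exact algebra.zero_le y
  | succ x ihx =>
    rw [toOrdinal_succ, Order.succ_le_iff] at h
    -- The hypothesis is now strict: the ordinal of `x` is below that of `y`. The inner induction
    -- descends through limits in `y` until a successor is reached.
    induction y using induction with
    | zero => simp [toOrdinal_zero] at h
    | succ y _ =>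
      rw [toOrdinal_succ, Order.lt_succ_iff] at h
      exact algebra.succ_mono x y (ihx h)
    | limit g hg ihy =>
      -- Strictness is essential: an ordinal merely `≤` a supremum need not be `≤` any term.
      rw [toOrdinal_limit, Ordinal.lt_iSup_iff] at h
      obtain ⟨n, hn⟩ := h
      exact algebra.le_cocone _ g hg n (ihy n hn)
  | limit f hf ih =>
    rw [toOrdinal_limit] at h
    exact algebra.le_limiting y f hf fun k =>
      ih k ((Ordinal.le_iSup (fun n => toOrdinal (f n)) k).trans h)

theorem toOrdinal_lt_iff {x y : Brw} : toOrdinal x < toOrdinal y ↔ x < y :=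
  ⟨fun h => le_of_toOrdinal_le ((toOrdinal_succ x).trans_le (Order.succ_le_of_lt h)),
    toOrdinal_strictMono⟩

end Brw

theorem theorem35 :
    WellFounded (fun x y : Brw => x < y) ∧
    ∀ (f : ℕ → Brw) (hf : IsIncreasing (fun x y : Brw => x < y) f) (x : Brw),
      x < Brw.limit f hf → ∃ n : ℕ, x < f n := by
  refine ⟨Subrelation.wf Brw.toOrdinal_strictMono (InvImage.wf Brw.toOrdinal Ordinal.lt_wf),
    fun f hf x h => ?_⟩
  -- The index `n` comes from the ordinals and is carried back by order reflection.
  rw [← Brw.toOrdinal_lt_iff, Brw.toOrdinal_limit, Ordinal.lt_iSup_iff] at h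
  exact h.imp fun n => Brw.toOrdinal_lt_iff.1
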